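/- For positive integers $a_1,\dots,a_m$ with even sum, put $N=\tfrac12(a_1+\dots+a_m)$ and let the Kostka number $K(a_1,\dots,a_m)$ be the number of semistandard Young tableaux of shape $(N,N)$ and content $(a_1,\dots,a_m)$: arrays with two rows of $N$ integers each, increasing weakly along each row and strictly down each column, in which each $i=1,\dots,m$ occurs exactly $a_i$ times. In these sequences, $a^\mu$ denotes $\mu$ consecutive entries equal to $a$. Then for all integers $a\ge 3$ and $\mu\ge 2$ with $a\mu$ even, \[ K(a^\mu,\,2a)\;<\;K\bigl(a^\mu,\,(a-1)^2\bigr). \] -/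

import Mathlib

/-- The Young diagram with two rows of length `N`. -/
def twoRowDiagram (N : ℕ) : YoungDiagram :=
  YoungDiagram.ofRowLens (List.replicate 2 N) (List.Pairwise.sortedGE (by simp))

/-- The tableau `T` has content `a = (a₁, …, aₘ)`: the `k`-th letter occurs `aₖ` times, and no
other letter occurs. As Mathlib's tableaux use the letters `0, 1, 2, …`, the letters `1, …, m`
are represented by `0, …, m - 1`. -/
def HasContent {D : YoungDiagram} (T : SemistandardYoungTableau D) (a : List ℕ) : Prop :=
  ∀ k : ℕ, (D.cells.filter fun c => T c.1 c.2 = k).card = a.getD k 0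

/-- The set of semistandard Young tableaux of shape `(N, N)`, with `2N` the sum of `a`, and of
content `a`. If the sum of `a` is odd, there are none. -/
def kostkaTableaux (a : List ℕ) : Set (SemistandardYoungTableau (twoRowDiagram (a.sum / 2))) :=
  {T | HasContent T a}

/-- The two-row Kostka number `K(a₁, …, aₘ)`. -/
noncomputable def kostka (a : List ℕ) : ℕ :=
  (kostkaTableaux a).ncard

theorem mem_twoRowDiagram {N i j : ℕ} : (i, j) ∈ twoRowDiagram N ↔ i < 2 ∧ j < N := by
  unfold twoRowDiagram
  rw [YoungDiagram.mem_ofRowLens]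
  simp only [List.length_replicate, List.getElem_replicate, exists_prop]

/-- The set of tableaux is finite, so that `kostka` really counts its elements. -/
theorem kostkaTableaux_finite (a : List ℕ) : (kostkaTableaux a).Finite := by
  classical
  have hb : ∀ T ∈ kostkaTableaux a, ∀ c ∈ (twoRowDiagram (a.sum / 2)).cells,
      T c.1 c.2 < a.length := by
    intro T hT c hc
    by_contra! h
    have h1 := hT (T c.1 c.2)
    rw [List.getD_eq_default _ _ h, Finset.card_eq_zero] at h1
    have h2 : c ∈ (twoRowDiagram (a.sum / 2)).cells.filter
        fun d => T d.1 d.2 = T c.1 c.2 := by simp [hc]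
    rw [h1] at h2
    simp at h2
  rw [← Set.finite_coe_iff]
  refine Finite.of_injective
    (fun (T : kostkaTableaux a) (c : (twoRowDiagram (a.sum / 2)).cells) =>
      (⟨T.1 c.1.1 c.1.2, hb T.1 T.2 c.1 c.2⟩ : Fin a.length)) ?_
  intro S T h
  apply Subtype.ext
  ext i j
  by_cases hc : (i, j) ∈ (twoRowDiagram (a.sum / 2)).cells
  · have := congrFun h ⟨(i, j), hc⟩
    simpa using this
  · rw [S.1.zeros (by simpa using hc), T.1.zeros (by simpa using hc)]

/-! Let M(k) be the multiplicity of the SL₂-module V_k, of dimension k+1, in V_a^{⊗μ}; `pathCount`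
computes it by Clebsch–Gordan, the two-row Pieri rule. Then K(a^μ, 2a) = M(2a) and K(a^μ, (a-1)²) =
M(0) + M(2) + ... + M(2a-2).

The key is that M(k)/(k+1) is antitone along each parity class (`dimAntitone_pathCount_const`).
Weighting by 1 + 3 + ... + (2a-1) = a² gives a² M(2a) ≤ (2a+1) ∑ M(j), and a² > 2a+1 for a ≥ 3. If
M(2a) = 0, positivity of M(0) suffices.

The antitonicity is proved by induction on μ in `DimAntitone.stepSum`, which also needs the weaker
`WindowBound` one tensor power earlier. Tableaux are matched with paths through the counts of small
entries in the second row (`bijOn_rowCount`, `card_secondRowCounts`). -/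

/-! ### The Pieri step and its increments. -/

/-- One step of the two-row Pieri rule: `stepSum a g k` is the sum of `g` over the differences
of row lengths from which a horizontal strip of size `a` leads to the difference `k`. -/
def stepSum (a : ℕ) (g : ℕ → ℕ) (k : ℕ) : ℕ :=
  ∑ e ∈ Finset.range (min a k + 1), g (k + a - 2 * e)

theorem stepSum_of_le {a k : ℕ} (g : ℕ → ℕ) (h : a ≤ k) :
    stepSum a g k = ∑ e ∈ Finset.range (a + 1), g (k + a - 2 * e) := by
  rw [stepSum, min_eq_left h]

theorem stepSum_of_ge {a k : ℕ} (g : ℕ → ℕ) (h : k ≤ a) :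
    stepSum a g k = ∑ e ∈ Finset.range (k + 1), g (k + a - 2 * e) := by
  rw [stepSum, min_eq_right h]

theorem stepSum_add_two_of_le {a k : ℕ} (g : ℕ → ℕ) (h : a ≤ k) :
    stepSum a g (k + 2) + g (k - a) = stepSum a g k + g (k + a + 2) := by
  rw [stepSum_of_le g h, stepSum_of_le g (by omega : a ≤ k + 2), Finset.sum_range_succ',
    Finset.sum_range_succ (fun e => g (k + a - 2 * e))]
  have h1 : ∀ e ∈ Finset.range a, g (k + 2 + a - 2 * (e + 1)) = g (k + a - 2 * e) := by
    intro e _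
    congr 1
    omega
  rw [Finset.sum_congr rfl h1, show k + 2 + a - 2 * 0 = k + a + 2 by omega,
    show k + a - 2 * a = k - a by omega]
  ring

theorem stepSum_add_two_of_ge {a k : ℕ} (g : ℕ → ℕ) (h : k + 2 ≤ a) :
    stepSum a g (k + 2) = stepSum a g k + g (k + a + 2) + g (a - k - 2) := by
  rw [stepSum_of_ge g h, stepSum_of_ge g (by omega : k ≤ a), Finset.sum_range_succ',
    Finset.sum_range_succ]
  have h1 : ∀ e ∈ Finset.range (k + 1), g (k + 2 + a - 2 * (e + 1)) = g (k + a - 2 * e) := by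
    intro e _
    congr 1
    omega
  rw [Finset.sum_congr rfl h1, show k + 2 + a - 2 * 0 = k + a + 2 by omega,
    show k + 2 + a - 2 * (k + 1 + 1) = a - k - 2 by omega]
  ring

theorem stepSum_add_two_of_eq {a k : ℕ} (g : ℕ → ℕ) (h : k + 1 = a) :
    stepSum a g (k + 2) = stepSum a g k + g (k + a + 2) := by
  subst h
  rw [stepSum_of_le g (by omega), stepSum_of_ge g (by omega), Finset.sum_range_succ']
  have h1 : ∀ e ∈ Finset.range (k + 1),
      g (k + 2 + (k + 1) - 2 * (e + 1)) = g (k + (k + 1) - 2 * e) := by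
    intro e _
    congr 1
    omega
  rw [Finset.sum_congr rfl h1, show k + 2 + (k + 1) - 2 * 0 = k + (k + 1) + 2 by omega]

/-! ### Multiplicity over dimension is antitone. -/

/-- The quotient `g k / (k + 1)` is antitone along each parity class. -/
def DimAntitone (g : ℕ → ℕ) : Prop :=
  ∀ k, g (k + 2) * (k + 1) ≤ g k * (k + 3)

theorem DimAntitone.le_add_two_mul {g : ℕ → ℕ} (hg : DimAntitone g) (k n : ℕ) :
    g (k + 2 * n) * (k + 1) ≤ g k * (k + 2 * n + 1) := by
  induction n with
  | zero => simp
  | succ n ih =>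
    have h := hg (k + 2 * n)
    have hpos : 0 < k + 2 * n + 1 := by omega
    refine Nat.le_of_mul_le_mul_right ?_ hpos
    calc g (k + 2 * (n + 1)) * (k + 1) * (k + 2 * n + 1)
        = g (k + 2 * n + 2) * (k + 2 * n + 1) * (k + 1) := by
          rw [show k + 2 * (n + 1) = k + 2 * n + 2 by ring]; ring
      _ ≤ g (k + 2 * n) * (k + 2 * n + 3) * (k + 1) := Nat.mul_le_mul_right _ h
      _ = g (k + 2 * n) * (k + 1) * (k + 2 * n + 3) := by ring
      _ ≤ g k * (k + 2 * n + 1) * (k + 2 * n + 3) := Nat.mul_le_mul_right _ ih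
      _ = _ := by ring

theorem DimAntitone.mul_le_mul {g : ℕ → ℕ} (hg : DimAntitone g) {j k : ℕ} (n : ℕ)
    (h : k = j + 2 * n) : g k * (j + 1) ≤ g j * (k + 1) := by
  subst h
  exact hg.le_add_two_mul j n

theorem sum_arith (T n : ℕ) (h : 2 * n ≤ T) :
    ∑ e ∈ Finset.range (n + 1), (T - 2 * e) = (n + 1) * (T - n) := by
  zify [h, (by omega : n ≤ T)]
  have h1 : ∀ e ∈ Finset.range (n + 1), ((T - 2 * e : ℕ) : ℤ) = (T : ℤ) - 2 * e := by
    intro e he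
    rw [Finset.mem_range] at he
    push_cast [(by omega : 2 * e ≤ T)]
    ring
  rw [Finset.sum_congr rfl h1]
  clear h1 h
  induction n with
  | zero => simp
  | succ n ih =>
    rw [Finset.sum_range_succ, ih]
    push_cast
    ring

/-- This is the dimension count for V_a ⊗ V_k. -/
theorem sum_dim_window (a k : ℕ) :
    ∑ e ∈ Finset.range (min a k + 1), (k + a + 1 - 2 * e) = (a + 1) * (k + 1) := by
  rw [sum_arith _ _ (by omega)]
  rcases le_total a k with h | h
  · rw [min_eq_left h, show k + a + 1 - a = k + 1 by omega]
  · rw [min_eq_right h, show k + a + 1 - k = a + 1 by omega, mul_comm]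

theorem DimAntitone.mul_le_stepSum {g : ℕ → ℕ} (hg : DimAntitone g) (a k : ℕ) :
    g (k + a + 2) * ((a + 1) * (k + 1)) ≤ stepSum a g k * (k + a + 3) := by
  rw [← sum_dim_window, Finset.mul_sum, stepSum, Finset.sum_mul]
  refine Finset.sum_le_sum fun e he => ?_
  rw [Finset.mem_range] at he
  have := hg.mul_le_mul (j := k + a - 2 * e) (k := k + a + 2) (e + 1) (by omega)
  rwa [show k + a - 2 * e + 1 = k + a + 1 - 2 * e by omega] at this

/-- A bound that makes `stepSum a g (a + d) + stepSum a g (a - d)` antitone in `d`, see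
`WindowBound.pair_le`. -/
def WindowBound (a : ℕ) (g : ℕ → ℕ) : Prop :=
  ∀ d, d + 2 ≤ a → g (2 * a + d + 2) ≤ 2 * g d + g (2 * a - d)

/-- All three arguments have the same parity, and 2(d+1) + (2a-d+1) = 2a+d+3 matches the dimension
weights exactly. -/
theorem DimAntitone.windowBound {g : ℕ → ℕ} (hg : DimAntitone g) (a : ℕ) : WindowBound a g := by
  intro d hd
  have h1 := hg.mul_le_mul (j := d) (k := 2 * a + d + 2) (a + 1) (by omega)
  have h2 := hg.mul_le_mul (j := 2 * a - d) (k := 2 * a + d + 2) (d + 1) (by omega)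
  have hpos : 0 < 2 * a + d + 3 := by omega
  refine Nat.le_of_mul_le_mul_right ?_ hpos
  have h3 : 2 * a - d + 1 + 2 * (d + 1) = 2 * a + d + 3 := by omega
  calc g (2 * a + d + 2) * (2 * a + d + 3)
      = 2 * (g (2 * a + d + 2) * (d + 1)) + g (2 * a + d + 2) * (2 * a - d + 1) := by
        rw [← h3]; ring
    _ ≤ 2 * (g d * (2 * a + d + 2 + 1)) + g (2 * a - d) * (2 * a + d + 2 + 1) := by
        gcongr
    _ = _ := by ring

theorem WindowBound.pair_le {a : ℕ} {g : ℕ → ℕ} (hg : WindowBound a g) {d : ℕ} (hd : d + 2 ≤ a) :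
    stepSum a g (a + (d + 2)) + stepSum a g (a - (d + 2)) ≤
      stepSum a g (a + d) + stepSum a g (a - d) := by
  have h1 := stepSum_add_two_of_le (a := a) (k := a + d) g (by omega)
  have h2 := stepSum_add_two_of_ge (a := a) (k := a - (d + 2)) g (by omega)
  have h3 := hg d hd
  rw [show a + d - a = d by omega, show a + d + a + 2 = 2 * a + d + 2 by omega] at h1
  rw [show a - (d + 2) + 2 = a - d by omega, show a - (d + 2) + a + 2 = 2 * a - d by omega,
    show a - (a - (d + 2)) - 2 = d by omega] at h2
  rw [show a + d + 2 = a + (d + 2) by omega] at h1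
  omega

theorem WindowBound.pair_le_of_le {a : ℕ} {g : ℕ → ℕ} (hg : WindowBound a g) (d n : ℕ)
    (hd : d + 2 * n ≤ a) :
    stepSum a g (a + (d + 2 * n)) + stepSum a g (a - (d + 2 * n)) ≤
      stepSum a g (a + d) + stepSum a g (a - d) := by
  induction n with
  | zero => simp
  | succ n ih =>
    exact (hg.pair_le (d := d + 2 * n) (by omega)).trans (ih (by omega))

/-- For k ≤ a the window a-k, ..., a+k is symmetric about a. Each of its reflected pairs dominates
the pair at distance k+2. -/
theorem WindowBound.mul_le_stepSum_stepSum {a : ℕ} {g : ℕ → ℕ} (hg : WindowBound a g) {k : ℕ}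
    (hk : k + 2 ≤ a) :
    (k + 1) * (stepSum a g (a + (k + 2)) + stepSum a g (a - (k + 2))) ≤
      2 * stepSum a (stepSum a g) k := by
  rw [stepSum_of_ge (stepSum a g) (by omega : k ≤ a), two_mul]
  nth_rewrite 2 [← Finset.sum_range_reflect]
  rw [← Finset.sum_add_distrib]
  have h : ∀ e ∈ Finset.range (k + 1),
      stepSum a g (a + (k + 2)) + stepSum a g (a - (k + 2)) ≤
        stepSum a g (k + a - 2 * e) + stepSum a g (k + a - 2 * (k + 1 - 1 - e)) := by
    intro e he
    rw [Finset.mem_range] at he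
    rcases le_total (2 * e) k with h | h
    · have := hg.pair_le_of_le (k - 2 * e) (e + 1) (by omega)
      rw [show k - 2 * e + 2 * (e + 1) = k + 2 by omega] at this
      rw [show k + a - 2 * e = a + (k - 2 * e) by omega,
        show k + a - 2 * (k + 1 - 1 - e) = a - (k - 2 * e) by omega]
      exact this
    · have := hg.pair_le_of_le (2 * e - k) (k - e + 1) (by omega)
      rw [show 2 * e - k + 2 * (k - e + 1) = k + 2 by omega] at this
      rw [show k + a - 2 * e = a - (2 * e - k) by omega,
        show k + a - 2 * (k + 1 - 1 - e) = a + (2 * e - k) by omega, add_comm (stepSum a g (a - _))]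
      exact this
  simpa using Finset.card_nsmul_le_sum _ _ _ h

/-- It suffices that (k+1) times the increment from k to k+2 is at most twice the value at k. The
increment depends on whether the window reflects at 0. -/
theorem DimAntitone.stepSum {a : ℕ} {g : ℕ → ℕ} (hg : WindowBound a g)
    (h : DimAntitone (stepSum a g)) : DimAntitone (stepSum a (_root_.stepSum a g)) := by
  intro k
  have hlow := h.mul_le_stepSum a k
  set m := _root_.stepSum a g with hm
  have hpos : 0 < k + a + 3 := by omega
  rcases lt_trichotomy (k + 1) a with hk | hk | hk
  · have h1 := stepSum_add_two_of_ge (a := a) (k := k) m (by omega)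
    have h2 := hg.mul_le_stepSum_stepSum (k := k) (by omega)
    rw [← hm] at h2
    rw [h1, show k + a + 2 = a + (k + 2) by omega, show a - k - 2 = a - (k + 2) by omega]
    linarith
  · rw [stepSum_add_two_of_eq m hk]
    have h2 : m (k + a + 2) * (k + 1) ≤ 2 * _root_.stepSum a m k := by
      refine Nat.le_of_mul_le_mul_right ?_ hpos
      subst hk
      nlinarith
    linarith
  -- Antitonicity bounds the lost term `m (k - a)` below, so the increment is at most `m (k + a +
  -- 2)` times (2a+2)/(k+a+3); `hlow` then closes the case.
  · have h1 := stepSum_add_two_of_le (a := a) (k := k) m (by omega)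
    have h2 := h.mul_le_mul (j := k - a) (k := k + a + 2) (a + 1) (by omega)
    obtain ⟨d, rfl⟩ : ∃ d, k = a + d := ⟨k - a, by omega⟩
    rw [show a + d - a = d by omega] at h1 h2
    refine Nat.le_of_mul_le_mul_right ?_ hpos
    zify at *
    have h3 : (_root_.stepSum a m (a + d + 2) : ℤ) =
      _root_.stepSum a m (a + d) + m (a + d + a + 2) - m d := by linarith
    rw [h3]
    have h4 := mul_le_mul_of_nonneg_right h2 (by positivity : (0 : ℤ) ≤ a + d + 1)
    nlinarith

/-! ### Path counts and the main inequality. -/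

/-- The number of paths of differences of row lengths from `0` to `k`, with the `i`-th step given
by a horizontal strip of size `a i`, for `i < m`. -/
def pathCount (a : ℕ → ℕ) : ℕ → ℕ → ℕ
  | 0 => fun k => if k = 0 then 1 else 0
  | m + 1 => stepSum (a m) (pathCount a m)

theorem pathCount_congr {a b : ℕ → ℕ} {m : ℕ} (h : ∀ i < m, a i = b i) :
    pathCount a m = pathCount b m := by
  induction m with
  | zero => rfl
  | succ m ih => rw [pathCount, pathCount, ih fun i hi => h i (by omega), h m (by omega)]

theorem pathCount_const_one (a k : ℕ) :
    pathCount (fun _ => a) 1 k = if k = a then 1 else 0 := by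
  simp only [pathCount, stepSum]
  by_cases h : k = a
  · subst h
    rw [Finset.sum_range_succ, Finset.sum_eq_zero]
    · simp; omega
    · intro e he
      rw [Finset.mem_range] at he
      rw [if_neg (by omega)]
  · rw [if_neg h]
    refine Finset.sum_eq_zero fun e he => ?_
    rw [Finset.mem_range] at he
    rw [if_neg (by omega)]

theorem pathCount_const_two (a k : ℕ) :
    pathCount (fun _ => a) 2 k = if Even k ∧ k ≤ 2 * a then 1 else 0 := by
  rw [pathCount, stepSum]
  simp only [pathCount_const_one]
  split_ifs with h
  · obtain ⟨⟨j, rfl⟩, hj⟩ := h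
    rw [Finset.sum_eq_single j]
    · rw [if_pos (by omega)]
    · intro e he hne
      rw [Finset.mem_range] at he
      rw [if_neg (by omega)]
    · intro hj'
      rw [Finset.mem_range] at hj'
      omega
  · refine Finset.sum_eq_zero fun e he => ?_
    rw [Finset.mem_range] at he
    refine if_neg fun h' => h ⟨⟨e, by omega⟩, by omega⟩

/-- One factor gives a point mass at a, which for a > 1 is not `DimAntitone` but satisfies
`WindowBound`; hence the induction carries both properties, one step apart. -/
theorem dimAntitone_pathCount_const (a μ : ℕ) :
    DimAntitone (pathCount (fun _ => a) (μ + 2)) := by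
  have h2 : DimAntitone (pathCount (fun _ => a) 2) := by
    intro k
    simp only [pathCount_const_two]
    by_cases h : Even (k + 2) ∧ k + 2 ≤ 2 * a
    · have h' : Even k ∧ k ≤ 2 * a := by
        refine ⟨?_, by omega⟩
        have := h.1
        rw [Nat.even_iff] at *
        omega
      rw [if_pos h, if_pos h']
      omega
    · rw [if_neg h]
      omega
  have h1 : WindowBound a (pathCount (fun _ => a) 1) := by
    intro d hd
    rw [pathCount_const_one, if_neg (by omega)]
    omega
  suffices h : WindowBound a (pathCount (fun _ => a) (μ + 1)) ∧
      DimAntitone (pathCount (fun _ => a) (μ + 2)) from h.2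
  induction μ with
  | zero => exact ⟨h1, h2⟩
  | succ μ ih => exact ⟨ih.2.windowBound a, DimAntitone.stepSum ih.1 ih.2⟩

theorem pathCount_const_top_pos (a μ : ℕ) : 0 < pathCount (fun _ => a) μ (μ * a) := by
  induction μ with
  | zero => simp [pathCount]
  | succ μ ih =>
    rw [pathCount, stepSum]
    refine ih.trans_le ?_
    have hm : a ∈ Finset.range (min a ((μ + 1) * a) + 1) := by
      rw [Finset.mem_range, min_eq_left (by nlinarith)]
      omega
    refine le_trans ?_ (Finset.single_le_sum (fun _ _ => Nat.zero_le _) hm)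
    rw [show (μ + 1) * a + a - 2 * a = μ * a by rw [add_mul]; omega]

theorem pathCount_const_lt_sum {a μ : ℕ} (ha : 3 ≤ a) (hμ : 2 ≤ μ) (heven : Even (a * μ)) :
    pathCount (fun _ => a) μ (2 * a) <
      ∑ e ∈ Finset.range a, pathCount (fun _ => a) μ (2 * a - 2 - 2 * e) := by
  have hM : DimAntitone (pathCount (fun _ => a) μ) := by
    obtain ⟨n, rfl⟩ : ∃ n, μ = n + 2 := ⟨μ - 2, by omega⟩
    exact dimAntitone_pathCount_const a n
  have htop := pathCount_const_top_pos a μ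
  set M := pathCount (fun _ => a) μ
  have h0 : 0 < M 0 := by
    obtain ⟨j, hj⟩ := heven
    -- Positivity at the top weight μa descends to 0, which has the same parity because aμ is even.
    have := hM.mul_le_mul (j := 0) (k := μ * a) j (by rw [mul_comm, hj]; omega)
    by_contra h
    rw [show M 0 = 0 by omega] at this
    omega
  rcases Nat.eq_zero_or_pos (M (2 * a)) with hz | hp
  · rw [hz]
    refine h0.trans_le ?_
    have := Finset.single_le_sum (f := fun e => M (2 * a - 2 - 2 * e)) (fun _ _ => Nat.zero_le _)
      (Finset.mem_range.2 (by omega : a - 1 < a))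
    simpa [show 2 * a - 2 - 2 * (a - 1) = 0 by omega] using this
  · have hsum : M (2 * a) * (a * a) ≤
        (∑ e ∈ Finset.range a, M (2 * a - 2 - 2 * e)) * (2 * a + 1) := by
      have hs := sum_arith (2 * a - 1) (a - 1) (by omega)
      rw [show a - 1 + 1 = a by omega, show 2 * a - 1 - (a - 1) = a by omega] at hs
      rw [← hs, Finset.mul_sum, Finset.sum_mul]
      refine Finset.sum_le_sum fun e he => ?_
      rw [Finset.mem_range] at he
      have := hM.mul_le_mul (j := 2 * a - 2 - 2 * e) (k := 2 * a) (e + 1) (by omega)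
      rwa [show 2 * a - 2 - 2 * e + 1 = 2 * a - 1 - 2 * e by omega] at this
    refine Nat.lt_of_mul_lt_mul_right (a := 2 * a + 1) (lt_of_lt_of_le ?_ hsum)
    exact Nat.mul_lt_mul_of_pos_left (by nlinarith) hp

theorem pathCount_eq_zero {a : ℕ → ℕ} {m k : ℕ} (h : ∑ i ∈ Finset.range m, a i < k) :
    pathCount a m k = 0 := by
  induction m generalizing k with
  | zero =>
    rw [Finset.sum_range_zero] at h
    exact if_neg (by omega)
  | succ m ih =>
    rw [Finset.sum_range_succ] at h
    rw [pathCount, stepSum]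
    refine Finset.sum_eq_zero fun e he => ih ?_
    rw [Finset.mem_range] at he
    omega

/-! ### Counting second-row profiles. -/

open Classical in
/-- The functions that can occur as `i ↦ #{entries < i in the second row}` for a two-row
semistandard tableau with second row of length `q` and `a i` entries `i` for `i < m`. -/
noncomputable def secondRowCounts (a : ℕ → ℕ) : ℕ → ℕ → Finset (ℕ → ℕ)
  | 0, q => if q = 0 then {fun _ => 0} else ∅
  | m + 1, q =>
    ((Finset.range (q + 1)).filter
      fun r => q ≤ r + a m ∧ q + r ≤ ∑ i ∈ Finset.range m, a i).biUnion
      fun r => (secondRowCounts a m r).image fun R i => if i ≤ m then R i else q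

theorem mem_secondRowCounts {a : ℕ → ℕ} {m q : ℕ} {R : ℕ → ℕ} :
    R ∈ secondRowCounts a m q ↔ R 0 = 0 ∧ (∀ i, m ≤ i → R i = q) ∧
      ∀ i < m, R i ≤ R (i + 1) ∧ R (i + 1) ≤ R i + a i ∧
        R (i + 1) + R i ≤ ∑ j ∈ Finset.range i, a j := by
  classical
  induction m generalizing q R with
  | zero =>
    rw [secondRowCounts]
    split_ifs with h
    · subst h
      rw [Finset.mem_singleton]
      constructor
      · rintro rfl
        simp
      · intro h
        funext i
        exact h.2.1 i (Nat.zero_le _)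
    · simp only [Finset.notMem_empty, false_iff]
      intro h'
      exact h (by rw [← h'.2.1 0 le_rfl, h'.1])
  | succ m ih =>
    rw [secondRowCounts]
    simp only [Finset.mem_biUnion, Finset.mem_filter, Finset.mem_range, Finset.mem_image]
    constructor
    · rintro ⟨r, ⟨hr, h1, h2⟩, R', hR', rfl⟩
      obtain ⟨h3, h4, h5⟩ := ih.1 hR'
      refine ⟨by simpa using h3, fun i hi => if_neg (by omega), fun i hi => ?_⟩
      rcases Nat.lt_succ_iff_lt_or_eq.1 hi with hi' | rfl
      · simpa [show i ≤ m by omega, show i + 1 ≤ m by omega] using h5 i hi'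
      · have := h4 i le_rfl
        simp only [le_refl, if_true, Nat.not_succ_le_self, if_false, this]
        omega
    · rintro ⟨h0, hq, hs⟩
      have hm := hs m (by omega)
      rw [hq (m + 1) le_rfl] at hm
      refine ⟨R m, ⟨by omega, by omega, by omega⟩, fun i => if i ≤ m then R i else R m,
        ih.2 ⟨by simpa using h0, ?_, ?_⟩, ?_⟩
      · intro i hi
        split_ifs with h
        · rw [show i = m by omega]
        · rfl
      · intro i hi
        simpa [show i ≤ m by omega, show i + 1 ≤ m by omega] using hs i (by omega)
      · funext i
        by_cases h : i ≤ m
        · simp [h]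
        · simp [h, hq i (by omega)]

/-- Condition on the second-row length r before the last letter: the earlier difference of row
lengths is then A - 2r, with A the earlier total. -/
theorem card_secondRowCounts {a : ℕ → ℕ} {m q : ℕ} (h : 2 * q ≤ ∑ i ∈ Finset.range m, a i) :
    (secondRowCounts a m q).card = pathCount a m (∑ i ∈ Finset.range m, a i - 2 * q) := by
  classical
  induction m generalizing q with
  | zero =>
    have : q = 0 := by simpa using h
    subst this
    simp [secondRowCounts, pathCount]
  | succ m ih =>
    rw [secondRowCounts, Finset.card_biUnion]
    · rw [Finset.sum_range_succ] at h ⊢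
      rw [pathCount, stepSum]
      set A := ∑ i ∈ Finset.range m, a i with hA
      -- The index e is the number of last letters in the first row; values of e not attained force
      -- a difference larger than the number of boxes.
      refine Finset.sum_of_injOn (fun r : ℕ => a m + r - q) ?_ ?_ ?_ ?_
      · intro r hr s hs hrs
        simp only [Finset.coe_filter, Finset.mem_range, Set.mem_ofPred_eq] at hr hs hrs
        omega
      · intro r hr
        simp only [Finset.coe_filter, Finset.mem_range, Set.mem_ofPred_eq, Finset.coe_range,
          Set.mem_Iio] at hr ⊢
        omega
      · intro e he hne
        refine pathCount_eq_zero ?_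
        rw [← hA]
        by_contra hlt
        rw [Finset.mem_range] at he
        refine hne ⟨q + e - a m, ?_, ?_⟩
        · simp only [Finset.coe_filter, Finset.mem_range, Set.mem_ofPred_eq]
          omega
        · simp only
          omega
      · intro r hr
        simp only [Finset.mem_filter, Finset.mem_range] at hr
        rw [Finset.card_image_of_injOn, ih (by omega)]
        · congr 1
          omega
        · intro R hR S hS hRS
          have hR' := mem_secondRowCounts.1 hR
          have hS' := mem_secondRowCounts.1 hS
          funext i
          by_cases hi : i ≤ m
          · simpa [hi] using congrFun hRS i
          · rw [hR'.2.1 i (by omega), hS'.2.1 i (by omega)]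
    · intro r _ s _ hrs
      rw [Function.onFun, Finset.disjoint_left]
      intro R hR hS
      obtain ⟨R', hR', rfl⟩ := Finset.mem_image.1 hR
      obtain ⟨S', hS', h⟩ := Finset.mem_image.1 hS
      have h1 := congrFun h m
      simp only [le_refl, if_true] at h1
      rw [(mem_secondRowCounts.1 hR').2.1 m le_rfl, (mem_secondRowCounts.1 hS').2.1 m le_rfl] at h1
      exact hrs h1.symm

/-! ### Tableaux and their row counts. -/

theorem twoRowDiagram_cells (N : ℕ) :
    (twoRowDiagram N).cells = Finset.range 2 ×ˢ Finset.range N := by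
  ext ⟨i, j⟩
  rw [YoungDiagram.mem_cells, mem_twoRowDiagram]
  simp

/-- The number of entries less than `i` in row `r` of a tableau of shape `(N, N)`. -/
def rowCount {N : ℕ} (T : SemistandardYoungTableau (twoRowDiagram N)) (r i : ℕ) : ℕ :=
  ((Finset.range N).filter fun j => T r j < i).card

section rowCount

variable {N : ℕ} (T : SemistandardYoungTableau (twoRowDiagram N))

theorem rowCount_zero (r : ℕ) : rowCount T r 0 = 0 := by
  simp [rowCount]

theorem rowCount_le (r i : ℕ) : rowCount T r i ≤ N := by
  exact (Finset.card_filter_le _ _).trans_eq (Finset.card_range N)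

theorem rowCount_mono (r : ℕ) : Monotone (rowCount T r) := by
  intro i k hik
  refine Finset.card_le_card (Finset.monotone_filter_right _ ?_)
  intro j _ hj
  exact lt_of_lt_of_le hj hik

theorem rowCount_one_succ_le (i : ℕ) : rowCount T 1 (i + 1) ≤ rowCount T 0 i := by
  refine Finset.card_le_card fun j hj => ?_
  simp only [Finset.mem_filter, Finset.mem_range] at hj ⊢
  have := T.col_strict (i1 := 0) (i2 := 1) (j := j) (by omega) (mem_twoRowDiagram.2 (by omega))
  omega

theorem card_initial_segment {N : ℕ} {p : ℕ → Prop} [DecidablePred p]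
    (hp : ∀ j k, j ≤ k → k < N → p k → p j) {j : ℕ} (hj : j < N) :
    p j ↔ j < ((Finset.range N).filter p).card := by
  constructor
  · intro h
    have : Finset.range (j + 1) ⊆ (Finset.range N).filter p := by
      intro k hk
      rw [Finset.mem_range] at hk
      rw [Finset.mem_filter, Finset.mem_range]
      exact ⟨by omega, hp k j (by omega) hj h⟩
    simpa using Finset.card_le_card this
  · intro h
    by_contra hn
    have : (Finset.range N).filter p ⊆ Finset.range j := by
      intro k hk
      rw [Finset.mem_filter, Finset.mem_range] at hk
      rw [Finset.mem_range]
      by_contra hjk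
      exact hn (hp j k (by omega) hk.1 hk.2)
    have := Finset.card_le_card this
    rw [Finset.card_range] at this
    omega

theorem entry_lt_iff {r j i : ℕ} (hr : r < 2) (hj : j < N) : T r j < i ↔ j < rowCount T r i := by
  refine card_initial_segment (p := fun j => T r j < i) (fun j k hjk hk h => ?_) hj
  exact lt_of_le_of_lt (T.row_weak_of_le hjk (mem_twoRowDiagram.2 ⟨hr, hk⟩)) h

theorem rowCount_succ (r i : ℕ) :
    rowCount T r (i + 1) =
      rowCount T r i + ((Finset.range N).filter fun j => T r j = i).card := by
  rw [rowCount, rowCount, ← Finset.card_union_of_disjoint]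
  · congr 1
    ext j
    simp only [Finset.mem_filter, Finset.mem_union, Finset.mem_range]
    omega
  · rw [Finset.disjoint_left]
    intro j h1 h2
    simp only [Finset.mem_filter] at h1 h2
    omega

theorem card_cells_filter_eq (i : ℕ) :
    ((twoRowDiagram N).cells.filter fun c => T c.1 c.2 = i).card =
      ((Finset.range N).filter fun j => T 0 j = i).card +
        ((Finset.range N).filter fun j => T 1 j = i).card := by
  rw [twoRowDiagram_cells, Finset.card_filter, Finset.sum_product, Finset.sum_range_succ,
    Finset.sum_range_one, Finset.card_filter, Finset.card_filter]

theorem hasContent_iff {l : List ℕ} :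
    HasContent T l ↔
      ∀ i, rowCount T 0 i + rowCount T 1 i = ∑ j ∈ Finset.range i, l.getD j 0 := by
  unfold HasContent
  simp only [card_cells_filter_eq]
  constructor
  · intro h i
    induction i with
    | zero => simp [rowCount_zero]
    | succ i ih =>
      rw [Finset.sum_range_succ, ← ih, ← h i, rowCount_succ, rowCount_succ]
      ring
  · intro h i
    have h1 := h (i + 1)
    rw [Finset.sum_range_succ, ← h i, rowCount_succ, rowCount_succ] at h1
    omega

end rowCount

theorem sum_range_getD (l : List ℕ) :
    ∑ j ∈ Finset.range l.length, l.getD j 0 = l.sum := by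
  induction l with
  | nil => simp
  | cons x l ih =>
    rw [List.length_cons, Finset.sum_range_succ', List.sum_cons, ← ih]
    simp [add_comm]

theorem sum_range_getD_of_le {l : List ℕ} {i : ℕ} (hi : l.length ≤ i) :
    ∑ j ∈ Finset.range i, l.getD j 0 = l.sum := by
  rw [← sum_range_getD]
  symm
  refine Finset.sum_subset (Finset.range_mono hi) fun j _ hj => ?_
  rw [Finset.mem_range] at hj
  exact List.getD_eq_default _ _ (by omega)

/-- This inverts `entry_lt_iff`: it recovers an entry from the cumulative counts. The bound `hm`
keeps the infimum off the empty set. -/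
theorem sInf_lt_iff_of_monotone {S : ℕ → ℕ} (hS : Monotone S) (h0 : S 0 = 0) {m j : ℕ}
    (hm : j < S m) (i : ℕ) : sInf {k | j < S (k + 1)} < i ↔ j < S i := by
  have hne : {k | j < S (k + 1)}.Nonempty := ⟨m, lt_of_lt_of_le hm (hS (by omega))⟩
  constructor
  · intro h
    have hmem : j < S (sInf {k | j < S (k + 1)} + 1) := Nat.sInf_mem hne
    exact hmem.trans_le (hS h)
  · intro h
    rcases i with _ | i
    · omega
    · exact Nat.lt_succ_of_le (Nat.sInf_le h)

/-- The two-row tableau in which row `r` has `S r i` entries less than `i`. -/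
noncomputable def tableauOfCounts (N : ℕ) (S : ℕ → ℕ → ℕ) (hS : ∀ r, Monotone (S r))
    (h0 : ∀ r, S r 0 = 0) (m : ℕ) (hm : ∀ r, S r m = N) (hcol : ∀ i, S 1 (i + 1) ≤ S 0 i) :
    SemistandardYoungTableau (twoRowDiagram N) where
  entry r j := if r < 2 ∧ j < N then sInf {k | j < S r (k + 1)} else 0
  row_weak' := by
    intro r j k hjk hk
    rw [mem_twoRowDiagram] at hk
    rw [if_pos hk, if_pos (by omega), ← Nat.lt_succ_iff,
      sInf_lt_iff_of_monotone (hS r) (h0 r) (m := m) (by rw [hm]; omega)]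
    refine hjk.trans ?_
    rw [← sInf_lt_iff_of_monotone (hS r) (h0 r) (m := m) (by rw [hm]; omega)]
    exact Nat.lt_succ_self _
  col_strict' := by
    intro r s j hrs hs
    rw [mem_twoRowDiagram] at hs
    obtain rfl : s = 1 := by omega
    obtain rfl : r = 0 := by omega
    rw [if_pos hs, if_pos (by omega),
      sInf_lt_iff_of_monotone (hS 0) (h0 0) (m := m) (by rw [hm]; omega)]
    refine lt_of_lt_of_le ?_ (hcol _)
    rw [← sInf_lt_iff_of_monotone (hS 1) (h0 1) (m := m) (by rw [hm]; omega)]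
    exact Nat.lt_succ_self _
  zeros' := by
    intro r j h
    rw [mem_twoRowDiagram] at h
    exact if_neg h

theorem rowCount_tableauOfCounts {N : ℕ} {S : ℕ → ℕ → ℕ} (hS : ∀ r, Monotone (S r))
    (h0 : ∀ r, S r 0 = 0) {m : ℕ} (hm : ∀ r, S r m = N) (hN : ∀ r i, S r i ≤ N)
    (hcol : ∀ i, S 1 (i + 1) ≤ S 0 i)
    {r : ℕ} (hr : r < 2) (i : ℕ) :
    rowCount (tableauOfCounts N S hS h0 m hm hcol) r i = S r i := by
  have h : (Finset.range N).filter (fun j => tableauOfCounts N S hS h0 m hm hcol r j < i) =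
      Finset.range (S r i) := by
    ext j
    rw [Finset.mem_filter, Finset.mem_range, Finset.mem_range]
    have key : j < N → (tableauOfCounts N S hS h0 m hm hcol r j < i ↔ j < S r i) := by
      intro hj
      change (if r < 2 ∧ j < N then sInf {k | j < S r (k + 1)} else 0) < i ↔ _
      rw [if_pos ⟨hr, hj⟩, sInf_lt_iff_of_monotone (hS r) (h0 r) (m := m) (by rw [hm]; omega)]
    have := hN r i
    constructor
    · rintro ⟨h1, h2⟩
      exact (key h1).1 h2
    · intro h1
      exact ⟨by omega, (key (by omega)).2 h1⟩
  rw [rowCount, h, Finset.card_range]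

/-- The content determines the first-row counts from the second-row ones, and column strictness
becomes R(i+1) ≤ A(i) - R(i). -/
theorem bijOn_rowCount {l : List ℕ} (hl : Even l.sum) :
    Set.BijOn (fun T : SemistandardYoungTableau (twoRowDiagram (l.sum / 2)) => rowCount T 1)
      (kostkaTableaux l)
      (secondRowCounts (fun i => l.getD i 0) l.length (l.sum / 2) : Finset (ℕ → ℕ)) := by
  have h2N : 2 * (l.sum / 2) = l.sum := Nat.two_mul_div_two_of_even hl
  set N := l.sum / 2
  refine ⟨?_, ?_, ?_⟩
  · intro T hT
    have hT' := (hasContent_iff T).1 hT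
    rw [Finset.mem_coe, mem_secondRowCounts]
    beta_reduce
    refine ⟨rowCount_zero T 1, fun i hi => ?_, fun i _ => ⟨rowCount_mono T 1 (by omega), ?_, ?_⟩⟩
    · have h1 := hT' i
      rw [sum_range_getD_of_le hi] at h1
      have h2 := rowCount_le T 0 i
      have h3 := rowCount_le T 1 i
      omega
    · have h1 := hT' i
      have h2 := hT' (i + 1)
      rw [Finset.sum_range_succ] at h2
      have h3 := rowCount_mono T 0 (by omega : i ≤ i + 1)
      omega
    · rw [← hT' i]
      have := rowCount_one_succ_le T i
      omega
  · intro T hT T' hT' h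
    have h1 : ∀ i, rowCount T 1 i = rowCount T' 1 i := congrFun h
    have h0 : ∀ i, rowCount T 0 i = rowCount T' 0 i := by
      intro i
      have e1 := (hasContent_iff T).1 hT i
      have e2 := (hasContent_iff T').1 hT' i
      have := h1 i
      omega
    ext r j
    by_cases hc : r < 2 ∧ j < N
    · have hrc : ∀ i, rowCount T r i = rowCount T' r i := by
        obtain rfl | rfl : r = 0 ∨ r = 1 := by omega
        · exact h0
        · exact h1
      refine eq_of_forall_gt_iff fun i => ?_
      rw [entry_lt_iff T hc.1 hc.2, entry_lt_iff T' hc.1 hc.2, hrc]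
    · rw [T.zeros (by rwa [mem_twoRowDiagram]), T'.zeros (by rwa [mem_twoRowDiagram])]
  · intro R hR
    rw [Finset.mem_coe, mem_secondRowCounts] at hR
    obtain ⟨hR0, hRN, hRs⟩ := hR
    set A : ℕ → ℕ := fun i => ∑ j ∈ Finset.range i, l.getD j 0 with hA
    have hAs : ∀ i, A (i + 1) = A i + l.getD i 0 := fun i => Finset.sum_range_succ _ _
    have hAm : ∀ i, l.length ≤ i → A i = 2 * N := fun i hi => by
      rw [hA]
      simp only
      rw [sum_range_getD_of_le hi, h2N]
    -- Beyond the last letter R is constantly N and A is 2N, so the constraints extend to all i.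
    have hstep : ∀ i, R i ≤ R (i + 1) ∧ R (i + 1) ≤ R i + l.getD i 0 ∧ R (i + 1) + R i ≤ A i := by
      intro i
      rcases lt_or_ge i l.length with hi | hi
      · exact hRs i hi
      · rw [hRN i hi, hRN (i + 1) (by omega), hAm i hi]
        omega
    have hRm : Monotone R := monotone_nat_of_le_succ fun i => (hstep i).1
    have hRA : ∀ i, 2 * R i ≤ A i := fun i => by
      have := hstep i
      omega
    let S : ℕ → ℕ → ℕ := fun r i => if r = 0 then A i - R i else R i
    have hS0 : Monotone fun i => A i - R i := monotone_nat_of_le_succ fun i => by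
      have h1 := hstep i
      have h2 := hAs i
      have h3 := hRA i
      have h4 := hRA (i + 1)
      omega
    have hSm : ∀ r, Monotone (S r) := fun r => by
      by_cases hr : r = 0
      · simpa [S, hr] using hS0
      · simpa [S, hr] using hRm
    have hSN : ∀ r i, l.length ≤ i → S r i = N := fun r i hi => by
      have h1 := hAm i hi
      have h2 := hRN i hi
      simp only [S]
      split_ifs <;> omega
    have hSz : ∀ r, S r 0 = 0 := fun r => by simp [S, hR0, hA]
    have hcol : ∀ i, S 1 (i + 1) ≤ S 0 i := fun i => by
      have := hstep i
      simp only [S, if_true, one_ne_zero, if_false]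
      omega
    have hle : ∀ r i, S r i ≤ N := fun r i => by
      rw [← hSN r (max i l.length) (le_max_right _ _)]
      exact hSm r (le_max_left _ _)
    have hcount := fun r (hr : r < 2) i =>
      rowCount_tableauOfCounts hSm hSz (fun r => hSN r _ le_rfl) hle hcol hr i
    refine ⟨tableauOfCounts N S hSm hSz l.length (fun r => hSN r _ le_rfl) hcol, ?_, ?_⟩
    · refine (hasContent_iff _).2 fun i => ?_
      rw [hcount 0 (by omega), hcount 1 (by omega)]
      have := hRA i
      simp only [S, if_true, one_ne_zero, if_false]
      change _ = A i
      omega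
    · funext i
      change rowCount _ 1 i = _
      rw [hcount 1 (by omega)]
      simp [S]

/-! ### Kostka numbers as path counts. -/

theorem kostka_eq_pathCount {l : List ℕ} (hl : Even l.sum) :
    kostka l = pathCount (fun i => l.getD i 0) l.length 0 := by
  have h2N : 2 * (l.sum / 2) = l.sum := Nat.two_mul_div_two_of_even hl
  have hcard := card_secondRowCounts (a := fun i => l.getD i 0) (m := l.length) (q := l.sum / 2)
    (by rw [sum_range_getD, h2N])
  rw [sum_range_getD, h2N, Nat.sub_self] at hcard
  rw [kostka, ← hcard, ← Set.ncard_coe_finset, ← (bijOn_rowCount hl).image_eq,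
    (bijOn_rowCount hl).injOn.ncard_image]

theorem pathCount_getD_replicate_append (a μ : ℕ) (l : List ℕ) :
    pathCount (fun i => (List.replicate μ a ++ l).getD i 0) μ = pathCount (fun _ => a) μ := by
  refine pathCount_congr fun i hi => ?_
  rw [List.getD_append _ _ _ _ (by simpa using hi)]
  simp [List.getD_eq_getElem?_getD, hi]

theorem stepSum_zero_right (a : ℕ) (g : ℕ → ℕ) : stepSum a g 0 = g a := by
  simp [stepSum]

theorem kostka_replicate_append_singleton {a μ b : ℕ} (h : Even (μ * a + b)) :
    kostka (List.replicate μ a ++ [b]) = pathCount (fun _ => a) μ b := by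
  rw [kostka_eq_pathCount (by simpa using h)]
  simp only [List.length_append, List.length_replicate, List.length_singleton]
  rw [pathCount, pathCount_getD_replicate_append, stepSum_zero_right]
  simp

theorem kostka_replicate_append_pair {a μ b c : ℕ} (h : Even (μ * a + (b + c))) :
    kostka (List.replicate μ a ++ [b, c]) = stepSum b (pathCount (fun _ => a) μ) c := by
  rw [kostka_eq_pathCount (by simpa using h)]
  simp only [List.length_append, List.length_replicate, List.length_cons, List.length_nil]
  rw [pathCount, pathCount, pathCount_getD_replicate_append, stepSum_zero_right]
  simp

theorem lemmaL (a μ : ℕ) (ha : 3 ≤ a) (hμ : 2 ≤ μ) (heven : Even (a * μ)) :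
    kostka (List.replicate μ a ++ [2 * a]) <
      kostka (List.replicate μ a ++ [a - 1, a - 1]) := by
  have hev : Even (μ * a) := by rwa [mul_comm]
  rw [kostka_replicate_append_singleton (hev.add (even_two_mul a)),
    kostka_replicate_append_pair (hev.add (Even.add_self _)), stepSum_of_le _ le_rfl,
    show a - 1 + 1 = a by omega, show a - 1 + (a - 1) = 2 * a - 2 by omega]
  exact pathCount_const_lt_sum ha hμ heven
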